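/- Let $I_0\subseteq\mathbb R$ be an interval with more than one point, let $\mathcal J$ be an infinite countable set, let $\mathcal R=(R_\alpha)_{\alpha\in\mathcal J}$ be a family of points of $I_0$, and let $\beta:\mathcal J\to\mathbb R^+$, $\alpha\mapsto\beta_\alpha$, be such that $\{\alpha\in\mathcal J:\beta_\alpha\le 2^t\}$ is finite for every $t\in\mathbb N$. Let $\rho:\mathbb R^+\to\mathbb R^+$ satisfy $\lim_{t\to\infty}\rho(t)=0$, and let $u=\{u_n\}$ be a positive increasing sequence with $\lim_{n\to\infty}u_n=\infty$. Suppose that $(\mathcal R,\beta)$ is locally ubiquitous in $I_0$ relative to $(\rho,u)$, that is, there is a constant $\kappa>0$ such that for every bounded interval $I\subseteq I_0$ there is $n_0(I)$ with $$\Big|\,I\cap\bigcup_{\alpha\in\mathcal J:\ \beta_\alpha\le u_n}B(R_\alpha,\rho(u_n))\Big|\ \ge\ \kappa\,|I|\qquad\text{for all } n\ge n_0(I),$$ where $|\cdot|$ is Lebesgue measure on $\mathbb R$ and $B(x,r)=(x-r,x+r)$. Let $\Psi:\mathbb R^+\to\mathbb R^+$ be a decreasing (i.e. non-increasing) function, let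 $$\Lambda(\mathcal R,\beta,\Psi)=\{x\in I_0:\ |x-R_\alpha|<\Psi(\beta_\alpha)\text{ for infinitely many }\alpha\in\mathcal J\},$$ let $s\in(0,1)$, let $\mathcal H^s$ denote $s$-dimensional Hausdorff measure, and put $$G:=\limsup_{n\to\infty}\frac{\Psi(u_n)^s}{\rho(u_n)}\in[0,\infty].$$ (i) Suppose that $G=0$ and that $\Psi$ is $u$-regular, i.e. there is a constant $0<\lambda<1$ with $\Psi(u_{n+1})\le\lambda\,\Psi(u_n)$ for all sufficiently large $n$. If $\sum_{n=1}^\infty \Psi(u_n)^s/\rho(u_n)=\infty$, then $\mathcal H^s(\Lambda(\mathcal R,\beta,\Psi))=\infty$. (ii) Suppose that $G>0$ (possibly $G=\infty$). Then $\mathcal H^s(\Lambda(\mathcal R,\beta,\Psi))=\infty$. -/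

import Mathlib

open Filter MeasureTheory
open scoped ENNReal Topology

namespace Ubiquity

variable {J : Type*}

/-- The indices whose weight is at most `T`. For `T = u n` this is the set `J^u(n)`. -/
def indexSet (β : J → ℝ) (T : ℝ) : Set J :=
  {α | β α ≤ T}

/-- `Δ^u(ρ, n)`: the union of the balls `B(R_α, ρ(u_n))` over the indices `α` with
`β_α ≤ u_n`. -/
def delta (R β : J → ℝ) (ρ : ℝ → ℝ) (u : ℕ → ℝ) (n : ℕ) : Set ℝ :=
  ⋃ α ∈ indexSet β (u n), Metric.ball (R α) (ρ (u n))

/-- `(R, β)` is locally ubiquitous in `I₀` relative to `(ρ, u)`: there is one constant `κ > 0` such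
that every (bounded) interval `I ⊆ I₀` satisfies `|Δ^u(ρ, n) ∩ I| ≥ κ |I|` for all `n ≥ n₀(I)`. -/
def LocallyUbiquitous (I₀ : Set ℝ) (R β : J → ℝ) (ρ : ℝ → ℝ) (u : ℕ → ℝ) : Prop :=
  ∃ κ : ℝ, 0 < κ ∧ ∀ I : Set ℝ, I.OrdConnected → Bornology.IsBounded I → I ⊆ I₀ →
    ∀ᶠ n in atTop, ENNReal.ofReal κ * volume I ≤ volume (delta R β ρ u n ∩ I)

/-- `h` is `u`-regular: `h(u_{n+1}) ≤ c h(u_n)` for all large `n`, with a constant `0 < c < 1`. -/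
def IsRegularAlong (u : ℕ → ℝ) (h : ℝ → ℝ) : Prop :=
  ∃ c : ℝ, 0 < c ∧ c < 1 ∧ ∀ᶠ n in atTop, h (u (n + 1)) ≤ c * h (u n)

/-- `Λ(R, β, Ψ)`: the points `x` of `I₀` with `|x - R_α| < Ψ(β_α)` for infinitely many indices
`α`. -/
def limsupSet (I₀ : Set ℝ) (R β : J → ℝ) (Ψ : ℝ → ℝ) : Set ℝ :=
  {x | x ∈ I₀ ∧ {α : J | |x - R α| < Ψ (β α)}.Infinite}

/-- The ratio `Ψ(u_n)^s / ρ(u_n)`, a positive real number for positive `Ψ`, `ρ`, `u`, viewed in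
`[0, ∞]`. -/
noncomputable def ratio (Ψ ρ : ℝ → ℝ) (u : ℕ → ℝ) (s : ℝ) (n : ℕ) : ℝ≥0∞ :=
  ENNReal.ofReal (Ψ (u n) ^ s / ρ (u n))

/-- `G = limsup_n Ψ(u_n)^s / ρ(u_n)`, an element of `[0, ∞]`. -/
noncomputable def G (Ψ ρ : ℝ → ℝ) (u : ℕ → ℝ) (s : ℝ) : ℝ≥0∞ :=
  limsup (ratio Ψ ρ u s) atTop

end Ubiquity

/-!
Write `θ n = c * r n ^ s`, where `r n ≤ Ψ (u n)` are radii and `c > 0` is a small constant. Two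
facts together give infinite Hausdorff measure.

The first is a filling property (`UbiquitousLevels.exists_filling`): in every interval `I`,
disjoint balls of radii `θ n` about points `R α` with `β α ≤ u n`, for large `n`, fill a proportion
of `I` that does not depend on `c`. They are chosen greedily, level by level
(`exists_separatedBalls`). Ubiquity supplies about `|I| / δ` centres at level `n`, where
`δ = max (ρ (u n)) (θ n)`, so the balls available there have total length about `|I| * θ n / δ`,
and the series of these ratios diverges. The balls chosen earlier exclude few of these, because the
radii decay geometrically.

The second is a Cantor-type construction (`UbiquitousLevels.exists_child`). The balls of radius
`θ n` are shrunk to intervals of length `r n`, which are separated by gaps comparable with `θ n`. A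
set that meets two of the intervals must be as long as the gap. Consequently, if `c` is small
enough, a cover `U i` with `∑ (diam U i) ^ s` finite and `∑ diam U i` small compared with `|I|`
cannot be heavy near each of the shrunk intervals: near one of them it is again small compared with
that interval. As `c` may depend on the interval reached and on the cover, iteration yields a
nested sequence whose common point is well approximable and uncovered
(`UbiquitousLevels.exists_notMem_iUnion`). If the Hausdorff measure were finite, covers of this
kind would exist, with `∑ diam U i` arbitrarily small because `s < 1`
(`UbiquitousLevels.hausdorffMeasure_eq_top`).

In part (i), `r n = Ψ (u n)` and all large levels are used. In part (ii), the ratios stay away from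
zero along some subsequence of levels, so with `r n = min (Ψ (u n)) (ρ (u n) ^ (1 / s))`, which
tends to zero, a sparse enough subsequence has both geometric decay and a divergent sum.
-/

namespace Ubiquity

/-! ### Separated nets and one level of the selection -/

theorem exists_separated_net (Y : Finset ℝ) {δ : ℝ} (hδ : 0 < δ) :
    ∃ Z ⊆ Y, (∀ x ∈ Z, ∀ y ∈ Z, x ≠ y → δ ≤ |x - y|) ∧ ∀ y ∈ Y, ∃ z ∈ Z, |y - z| < δ := by
  classical
  induction Y using Finset.induction_on with
  | empty => exact ⟨∅, by simp, by simp, by simp⟩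
  | insert a Y _ ih =>
    obtain ⟨Z, hZY, hsep, hnet⟩ := ih
    by_cases h : ∃ z ∈ Z, |a - z| < δ
    · refine ⟨Z, hZY.trans (Finset.subset_insert _ _), hsep, fun y hy => ?_⟩
      rcases Finset.mem_insert.1 hy with rfl | hy
      exacts [h, hnet y hy]
    · push Not at h
      refine ⟨insert a Z, Finset.insert_subset_insert _ hZY, fun x hx y hy hxy => ?_,
        fun y hy => ?_⟩
      · rcases Finset.mem_insert.1 hx with hx' | hx' <;>
          rcases Finset.mem_insert.1 hy with hy' | hy'
        · exact absurd (hx'.trans hy'.symm) hxy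
        · exact hx' ▸ h y hy'
        · rw [abs_sub_comm]; exact hy' ▸ h x hx'
        · exact hsep x hx' y hy' hxy
      · rcases Finset.mem_insert.1 hy with rfl | hy
        · exact ⟨y, Finset.mem_insert_self _ _, by simpa using hδ⟩
        · obtain ⟨z, hz, hyz⟩ := hnet y hy
          exact ⟨z, Finset.mem_insert_of_mem hz, hyz⟩

/-- A finite family of pairs `(n, x)`, each standing for the ball of radius `θ n` about `x`, is
separated if these open balls are pairwise disjoint, expressed through the distances of the
centres. -/
def SeparatedBalls (θ : ℕ → ℝ) (F : Finset (ℕ × ℝ)) : Prop :=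
  ∀ p ∈ F, ∀ q ∈ F, p ≠ q → θ p.1 + θ q.1 ≤ |p.2 - q.2|

/-- One level of the greedy selection. Either a centre `x ∈ S` is close to a ball already in `F`,
and then `B(x, ρ)` lies in a slightly enlarged ball of `F`, or it is available, and the available
centres are covered by the balls of radius `3 δ` about a `2 δ`-separated net `Z`. Comparing
measures, `Z` has many elements unless the enlarged balls of `F` already have large measure. -/
theorem exists_level_extension {θ : ℕ → ℝ} (F : Finset (ℕ × ℝ))
    (hF : ∀ p ∈ F, 0 < θ p.1) (n : ℕ) {ρ δ : ℝ} (hδ : 0 < δ)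
    (hρδ : ρ ≤ δ) (hθδ : θ n ≤ δ) (S : Finset ℝ) (B : Set ℝ) {m : ℝ}
    (hm : ENNReal.ofReal m ≤ volume ((⋃ x ∈ S, Metric.ball x ρ) ∩ B)) :
    ∃ Z ⊆ S, (∀ x ∈ Z, (Metric.ball x ρ ∩ B).Nonempty) ∧
      (∀ x ∈ Z, ∀ y ∈ Z, x ≠ y → 2 * θ n ≤ |x - y|) ∧
      (∀ x ∈ Z, ∀ p ∈ F, θ p.1 + θ n ≤ |x - p.2|) ∧
      m ≤ 6 * δ * Z.card + ∑ p ∈ F, 2 * (θ p.1 + 2 * δ) := by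
  classical
  let Y := S.filter fun x => (Metric.ball x ρ ∩ B).Nonempty ∧ ∀ p ∈ F, θ p.1 + θ n ≤ |x - p.2|
  obtain ⟨Z, hZY, hsep, hnet⟩ := exists_separated_net Y (δ := 2 * δ) (by linarith)
  refine ⟨Z, hZY.trans (Finset.filter_subset _ _), fun x hx => (Finset.mem_filter.1 (hZY hx)).2.1,
    fun x hx y hy h => le_trans (by linarith) (hsep x hx y hy h),
    fun x hx => (Finset.mem_filter.1 (hZY hx)).2.2, ?_⟩
  have hcov : (⋃ x ∈ S, Metric.ball x ρ) ∩ B ⊆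
      (⋃ z ∈ Z, Metric.ball z (3 * δ)) ∪ ⋃ p ∈ F, Metric.ball p.2 (θ p.1 + 2 * δ) := by
    rintro y ⟨hy, hyB⟩
    simp only [Set.mem_iUnion] at hy
    obtain ⟨x, hx, hyx⟩ := hy
    have hyx' := hyx
    rw [Metric.mem_ball, Real.dist_eq] at hyx'
    by_cases hxY : x ∈ Y
    · obtain ⟨z, hz, hxz⟩ := hnet x hxY
      refine Or.inl (Set.mem_iUnion₂.2 ⟨z, hz, ?_⟩)
      rw [Metric.mem_ball, Real.dist_eq]
      have := abs_sub_le y x z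
      linarith
    · have : ¬ ∀ p ∈ F, θ p.1 + θ n ≤ |x - p.2| := fun h =>
        hxY (Finset.mem_filter.2 ⟨hx, ⟨y, hyx, hyB⟩, h⟩)
      push Not at this
      obtain ⟨p, hp, hlt⟩ := this
      refine Or.inr (Set.mem_iUnion₂.2 ⟨p, hp, ?_⟩)
      rw [Metric.mem_ball, Real.dist_eq]
      have := abs_sub_le y x p.2
      linarith
  have hsum : ∀ p ∈ F, 0 ≤ 2 * (θ p.1 + 2 * δ) := fun p hp => by have := hF p hp; positivity
  have h1 : volume (⋃ z ∈ Z, Metric.ball z (3 * δ)) ≤ ENNReal.ofReal (6 * δ * Z.card) := by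
    refine (measure_biUnion_finset_le _ _).trans (le_of_eq ?_)
    simp only [Real.volume_ball, Finset.sum_const, nsmul_eq_mul]
    rw [← ENNReal.ofReal_natCast, ← ENNReal.ofReal_mul (by positivity)]
    ring_nf
  have h2 : volume (⋃ p ∈ F, Metric.ball p.2 (θ p.1 + 2 * δ)) ≤
      ENNReal.ofReal (∑ p ∈ F, 2 * (θ p.1 + 2 * δ)) := by
    refine (measure_biUnion_finset_le _ _).trans (le_of_eq ?_)
    rw [ENNReal.ofReal_sum_of_nonneg hsum]
    simp only [Real.volume_ball]
  have h3 : ENNReal.ofReal m ≤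
      ENNReal.ofReal (6 * δ * Z.card + ∑ p ∈ F, 2 * (θ p.1 + 2 * δ)) := by
    rw [ENNReal.ofReal_add (by positivity) (Finset.sum_nonneg hsum)]
    exact hm.trans ((measure_mono hcov).trans ((measure_union_le _ _).trans (add_le_add h1 h2)))
  exact (ENNReal.ofReal_le_ofReal_iff (add_nonneg (by positivity) (Finset.sum_nonneg hsum))).1 h3

/-! ### Greedy selection of disjoint balls -/

/-- Greedy selection through the levels `N, N + 1, …`: it does not stop before the selected disjoint
balls have total radius at least `m / 4`. A ball selected at level `n` obstructs, at a later level
`k`, a set whose measure has one part proportional to `θ n`, harmless while the total radius is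
small, and one part of order `max (ρ k) (θ k)`. The losses of the second kind, weighted
by `θ k / max (ρ k) (θ k)`, sum to `O(θ n)` over `k` because `θ` decays geometrically. Hence the
total radius dominates the partial sums of the divergent series of `θ k / max (ρ k) (θ k)`. -/
theorem exists_separatedBalls {θ ρ : ℕ → ℝ} (hθ : ∀ n, 0 < θ n) {μ : ℝ} (hμ0 : 0 ≤ μ) (hμ1 : μ < 1)
    (hθμ : ∀ n, θ (n + 1) ≤ μ * θ n) (hdiv : ¬ Summable fun n => θ n / max (ρ n) (θ n))
    (S : ℕ → Finset ℝ) (B : Set ℝ) {m : ℝ} (hm0 : 0 < m) (N : ℕ)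
    (hm : ∀ n, N ≤ n → ENNReal.ofReal m ≤ volume ((⋃ x ∈ S n, Metric.ball x (ρ n)) ∩ B)) :
    ∃ F : Finset (ℕ × ℝ),
      (∀ p ∈ F, N ≤ p.1 ∧ p.2 ∈ S p.1 ∧ (Metric.ball p.2 (ρ p.1) ∩ B).Nonempty) ∧
      SeparatedBalls θ F ∧ m / 4 ≤ ∑ p ∈ F, θ p.1 := by
  classical
  by_contra hcon
  push Not at hcon
  -- `D` and `A` balance the potential `A * ∑ θ - D * θ n * #F` against the two kinds of loss.
  set D : ℝ := 4 / (1 - μ) with hD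
  have hD0 : 0 < D := div_pos (by norm_num) (by linarith)
  have hDμ : D * (1 - μ) = 4 := div_mul_cancel₀ _ (by linarith)
  set A : ℝ := 6 + D * μ with hA
  have hA0 : 0 < A := by positivity
  have key : ∀ k, ∃ F : Finset (ℕ × ℝ),
      (∀ p ∈ F, N ≤ p.1 ∧ p.2 ∈ S p.1 ∧ (Metric.ball p.2 (ρ p.1) ∩ B).Nonempty) ∧
      SeparatedBalls θ F ∧ (∀ p ∈ F, p.1 < N + k) ∧
      m / 2 * ∑ i ∈ Finset.range k, θ (N + i) / max (ρ (N + i)) (θ (N + i)) ≤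
        A * ∑ p ∈ F, θ p.1 - D * θ (N + k) * F.card := by
    intro k
    induction k with
    | zero => exact ⟨∅, by simp, by simp [SeparatedBalls], by simp, by simp⟩
    | succ k ih =>
      obtain ⟨F, hF, hsep, hlt, hpot⟩ := ih
      set n := N + k with hn
      have hδ0 : 0 < max (ρ n) (θ n) := lt_max_of_lt_right (hθ n)
      obtain ⟨Z, hZS, hZB, hZZ, hZF, hmeas⟩ := exists_level_extension (θ := θ) F
        (fun p _ => hθ p.1) n hδ0 (le_max_left _ _) (le_max_right _ _) (S n) B
        (hm n (Nat.le_add_right _ _))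
      set δ := max (ρ n) (θ n) with hδ
      have hT := hcon F hF hsep
      have hdisj : Disjoint F (Z.image fun x => (n, x)) := by
        rw [Finset.disjoint_left]
        intro p hp hp'
        obtain ⟨x, _, rfl⟩ := Finset.mem_image.1 hp'
        exact absurd (hlt _ hp) (lt_irrefl _)
      have hinj : Function.Injective fun x : ℝ => (n, x) := fun x y h => (Prod.mk.inj h).2
      have hsum : ∑ p ∈ F ∪ Z.image (fun x => (n, x)), θ p.1 =
          ∑ p ∈ F, θ p.1 + Z.card * θ n := by
        rw [Finset.sum_union hdisj, Finset.sum_image fun x _ y _ h => hinj h]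
        simp
      have hcard : ((F ∪ Z.image (fun x => (n, x))).card : ℝ) = F.card + Z.card := by
        rw [Finset.card_union_of_disjoint hdisj, Finset.card_image_of_injective _ hinj]
        push_cast; rfl
      refine ⟨F ∪ Z.image (fun x => (n, x)), ?_, ?_, ?_, ?_⟩
      · intro p hp
        rcases Finset.mem_union.1 hp with hp | hp
        · exact hF p hp
        · obtain ⟨x, hx, rfl⟩ := Finset.mem_image.1 hp
          exact ⟨Nat.le_add_right _ _, hZS hx, hZB x hx⟩
      · intro p hp q hq hpq
        rcases Finset.mem_union.1 hp with hp | hp <;> rcases Finset.mem_union.1 hq with hq | hq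
        · exact hsep p hp q hq hpq
        · obtain ⟨x, hx, rfl⟩ := Finset.mem_image.1 hq
          rw [abs_sub_comm]
          exact hZF x hx p hp
        · obtain ⟨x, hx, rfl⟩ := Finset.mem_image.1 hp
          rw [add_comm]
          exact hZF x hx q hq
        · obtain ⟨x, hx, rfl⟩ := Finset.mem_image.1 hp
          obtain ⟨y, hy, rfl⟩ := Finset.mem_image.1 hq
          have := hZZ x hx y hy fun h => hpq (by rw [h])
          dsimp only
          linarith
      · intro p hp
        rcases Finset.mem_union.1 hp with hp | hp
        · have := hlt p hp; omega
        · obtain ⟨x, hx, rfl⟩ := Finset.mem_image.1 hp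
          dsimp only; omega
      · rw [Finset.sum_range_succ, hsum, hcard, mul_add, ← add_assoc, ← hn, ← hδ]
        have e1 : ∑ p ∈ F, 2 * (θ p.1 + 2 * δ) = 2 * ∑ p ∈ F, θ p.1 + 4 * δ * F.card := by
          rw [← Finset.mul_sum, Finset.sum_add_distrib]
          simp only [Finset.sum_const, nsmul_eq_mul]
          ring
        have e2 : m / 2 ≤ δ * (6 * Z.card + 4 * F.card) := by
          rw [e1] at hmeas
          linarith
        have e3 : m / 2 * (θ n / δ) ≤ θ n * (6 * Z.card + 4 * F.card) := by
          rw [← mul_div_assoc, div_le_iff₀ hδ0]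
          nlinarith [mul_le_mul_of_nonneg_left e2 (hθ n).le]
        have e4 : D * θ (n + 1) * (F.card + Z.card) ≤ D * (μ * θ n) * (F.card + Z.card) := by
          gcongr
          exact hθμ n
        have e5 : D * (μ * θ n) * (F.card : ℝ) = D * θ n * F.card - 4 * θ n * F.card := by
          rw [← hDμ]; ring
        have e6 : A * (∑ p ∈ F, θ p.1 + Z.card * θ n) =
            A * ∑ p ∈ F, θ p.1 + 6 * (Z.card * θ n) + D * (μ * θ n) * Z.card := by
          rw [hA]; ring
        rw [e6]
        nlinarith
  have hdiv' : ¬ Summable fun i => θ (N + i) / max (ρ (N + i)) (θ (N + i)) := by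
    simp_rw [add_comm N]
    exact fun h => hdiv ((summable_nat_add_iff N).1 h)
  have hnn : ∀ i, 0 ≤ θ (N + i) / max (ρ (N + i)) (θ (N + i)) := fun i =>
    div_nonneg (hθ _).le ((hθ _).le.trans (le_max_right _ _))
  refine hdiv' (summable_of_sum_range_le (c := A / 2) hnn fun k => ?_)
  obtain ⟨F, hF, hsep, -, hpot⟩ := key k
  have h1 := hcon F hF hsep
  have h2 : 0 ≤ D * θ (N + k) * F.card := by have := hθ (N + k); positivity
  have h3 := mul_lt_mul_of_pos_left h1 hA0
  have h4 : m * ∑ i ∈ Finset.range k, θ (N + i) / max (ρ (N + i)) (θ (N + i)) ≤ m * (A / 2) := by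
    linarith
  exact le_of_mul_le_mul_left h4 hm0

/-! ### Ubiquitous levels and the filling property -/

/-- A sequence of finite sets `S n` of centres, ubiquitous on `[a, b]` at the scales `ρ n`, together
with geometrically decaying radii `r n` whose `s`-th powers have divergent sum
relative to `ρ n`. -/
structure UbiquitousLevels (a b κ s : ℝ) (S : ℕ → Finset ℝ) (ρ r : ℕ → ℝ) : Prop where
  s_pos : 0 < s
  s_lt_one : s < 1
  κ_pos : 0 < κ
  κ_le_one : κ ≤ 1
  ρ_pos : ∀ n, 0 < ρ n
  tendsto_ρ : Tendsto ρ atTop (𝓝 0)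
  r_pos : ∀ n, 0 < r n
  decay : ∃ l : ℝ, 0 < l ∧ l < 1 ∧ ∀ n, r (n + 1) ≤ l * r n
  not_summable : ¬ Summable fun n => r n ^ s / ρ n
  ubiquitous : ∀ p q, a ≤ p → p < q → q ≤ b → ∀ᶠ n in atTop,
    ENNReal.ofReal (κ * (q - p)) ≤ volume ((⋃ x ∈ S n, Metric.ball x (ρ n)) ∩ Set.Icc p q)

theorem not_summable_div_max {x ρ : ℕ → ℝ} (h : ¬ Summable fun n => x n / ρ n) {c : ℝ} (hc : 0 < c)
    (hx : ∀ n, 0 < x n) : ¬ Summable fun n => c * x n / max (ρ n) (c * x n) := by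
  intro hs
  have h1 : ∀ᶠ n in atTop, c * x n / max (ρ n) (c * x n) < 1 :=
    hs.tendsto_atTop_zero.eventually (gt_mem_nhds one_pos)
  have h2 : (fun n => c * x n / max (ρ n) (c * x n)) =ᶠ[atTop] fun n => c * (x n / ρ n) := by
    filter_upwards [h1] with n hn
    have hpos : 0 < c * x n := mul_pos hc (hx n)
    rcases le_total (ρ n) (c * x n) with hle | hle
    · rw [max_eq_right hle, div_self hpos.ne'] at hn
      exact absurd hn (lt_irrefl _)
    · rw [max_eq_left hle, mul_div_assoc]
  exact h ((summable_mul_left_iff hc.ne').1 ((summable_congr_atTop h2).1 hs))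

namespace UbiquitousLevels

variable {a b κ s : ℝ} {S : ℕ → Finset ℝ} {ρ r : ℕ → ℝ}

theorem tendsto_r (H : UbiquitousLevels a b κ s S ρ r) : Tendsto r atTop (𝓝 0) := by
  obtain ⟨l, hl0, hl1, hl⟩ := H.decay
  have h : ∀ n, r n ≤ r 0 * l ^ n := by
    intro n
    induction n with
    | zero => simp
    | succ n ih =>
      calc r (n + 1) ≤ l * r n := hl n
        _ ≤ l * (r 0 * l ^ n) := by gcongr
        _ = r 0 * l ^ (n + 1) := by ring
  refine squeeze_zero (fun n => (H.r_pos n).le) h ?_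
  simpa using (tendsto_pow_atTop_nhds_zero_of_lt_one hl0.le hl1).const_mul (r 0)

/-- For every `c > 0`, however small, a fixed proportion of an interval `[p, q]` is filled by
disjoint balls of radii `c * r n ^ s`, with `n` large and centres in `S n`. -/
theorem exists_filling (H : UbiquitousLevels a b κ s S ρ r) {p q : ℝ} (hp : a ≤ p) (hpq : p < q)
    (hq : q ≤ b) {c : ℝ} (hc : 0 < c) (N : ℕ) :
    ∃ F : Finset (ℕ × ℝ),
      (∀ x ∈ F, N ≤ x.1 ∧ x.2 ∈ S x.1 ∧ r x.1 ≤ c * r x.1 ^ s ∧ r x.1 ≤ (q - p) / 2 ∧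
        p ≤ x.2 - r x.1 / 2 ∧ x.2 + r x.1 / 2 ≤ q) ∧
      SeparatedBalls (fun n => c * r n ^ s) F ∧
      κ * (q - p) / 8 ≤ ∑ x ∈ F, c * r x.1 ^ s := by
  obtain ⟨l, hl0, hl1, hl⟩ := H.decay
  have hs := H.s_pos
  have hr := H.r_pos
  have hrs : ∀ n, 0 < r n ^ s := fun n => Real.rpow_pos_of_pos (hr n) s
  have hlen : 0 < q - p := sub_pos.2 hpq
  have e1 := H.ubiquitous (p + (q - p) / 4) (q - (q - p) / 4) (by linarith) (by linarith)
    (by linarith)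
  have e2 : ∀ᶠ n in atTop, ρ n < (q - p) / 8 :=
    H.tendsto_ρ.eventually (gt_mem_nhds (by positivity))
  have e3 : ∀ᶠ n in atTop, r n < (q - p) / 8 :=
    H.tendsto_r.eventually (gt_mem_nhds (by positivity))
  have e4 : ∀ᶠ n in atTop, r n ^ (1 - s) < c := by
    have := H.tendsto_r.rpow_const (p := 1 - s) (Or.inr (by linarith [H.s_lt_one]))
    rw [Real.zero_rpow (by linarith [H.s_lt_one])] at this
    exact this.eventually (gt_mem_nhds hc)
  obtain ⟨N', hN'⟩ := eventually_atTop.1 (e1.and (e2.and (e3.and e4)))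
  have hm : 0 < κ * (q - p) / 2 := by have := H.κ_pos; positivity
  obtain ⟨F, hF, hsep, hsum⟩ := exists_separatedBalls (θ := fun n => c * r n ^ s) (ρ := ρ)
    (fun n => mul_pos hc (hrs n)) (μ := l ^ s) (by positivity) (Real.rpow_lt_one hl0.le hl1 hs)
    (fun n => by
      have := Real.rpow_le_rpow (hr _).le (hl n) hs.le
      rw [Real.mul_rpow hl0.le (hr n).le] at this
      nlinarith)
    (not_summable_div_max H.not_summable hc hrs) S
    (Set.Icc (p + (q - p) / 4) (q - (q - p) / 4)) hm (max N N')
    (fun n hn => by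
      have := (hN' n (le_trans (le_max_right _ _) hn)).1
      convert this using 2
      ring)
  refine ⟨F, fun x hx => ?_, hsep, by linarith⟩
  obtain ⟨hNx, hxS, y, hyx, hyB⟩ := hF x hx
  obtain ⟨-, h2, h3, h4⟩ := hN' x.1 (le_trans (le_max_right _ _) hNx)
  rw [Metric.mem_ball, Real.dist_eq, abs_lt] at hyx
  refine ⟨le_trans (le_max_left _ _) hNx, hxS, ?_, by linarith, ?_, ?_⟩
  · calc r x.1 = r x.1 ^ (1 - s) * r x.1 ^ s := by
          rw [← Real.rpow_add (hr _)]; simp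
      _ ≤ c * r x.1 ^ s := mul_le_mul_of_nonneg_right h4.le (hrs _).le
  · linarith [hyB.1, hyB.2]
  · linarith [hyB.1, hyB.2]

end UbiquitousLevels

/-- If a set of diameter at most `d` meets at least two of the small concentric intervals
`[x - h n, x + h n]`, where the radii satisfy `h n ≤ θ n / 2`, then it has to cross the gaps
between them, so that the balls concerned have total radius `O(d)`. -/
theorem sum_radius_le_of_meets {θ h : ℕ → ℝ} {F : Finset (ℕ × ℝ)} (hF : SeparatedBalls θ F)
    (hnt : F.Nontrivial) (hθ : ∀ p ∈ F, 0 < θ p.1) (hh : ∀ p ∈ F, 2 * h p.1 ≤ θ p.1)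
    {U : Set ℝ} {d : ℝ} (hU : ∀ x ∈ U, ∀ y ∈ U, |x - y| ≤ d)
    (hmeet : ∀ p ∈ F, (U ∩ Set.Icc (p.2 - h p.1) (p.2 + h p.1)).Nonempty) :
    ∑ p ∈ F, θ p.1 ≤ 4 * d := by
  have hθd : ∀ p ∈ F, θ p.1 ≤ 2 * d := by
    intro p hp
    obtain ⟨q, hq, hqp⟩ := hnt.exists_ne p
    obtain ⟨x, hxU, hx⟩ := hmeet p hp
    obtain ⟨y, hyU, hy⟩ := hmeet q hq
    have h1 := hF p hp q hq hqp.symm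
    have h2 := hU x hxU y hyU
    have h3 := hh p hp
    have h4 := hh q hq
    have h5 := hθ q hq
    have h6 : |p.2 - q.2| ≤ |p.2 - x| + |x - y| + |y - q.2| := by
      have e1 := abs_sub_le p.2 x q.2
      have e2 := abs_sub_le x y q.2
      linarith
    have h7 : |p.2 - x| ≤ h p.1 := abs_le.2 ⟨by linarith [hx.2], by linarith [hx.1]⟩
    have h8 : |y - q.2| ≤ h q.1 := abs_le.2 ⟨by linarith [hy.1], by linarith [hy.2]⟩
    linarith
  obtain ⟨p₀, hp₀⟩ := hnt.nonempty
  obtain ⟨y₀, hy₀, -⟩ := hmeet p₀ hp₀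
  have hd : 0 < d := by linarith [hθ p₀ hp₀, hθd p₀ hp₀]
  have hdisj : Set.PairwiseDisjoint (F : Set (ℕ × ℝ)) fun p => Metric.ball p.2 (θ p.1) := by
    intro p hp q hq hpq
    exact Metric.ball_disjoint_ball (by rw [Real.dist_eq]; exact hF p hp q hq hpq)
  have hsub : (⋃ p ∈ F, Metric.ball p.2 (θ p.1)) ⊆ Metric.ball y₀ (4 * d) := by
    refine Set.iUnion₂_subset fun p hp => Metric.ball_subset_ball' ?_
    obtain ⟨x, hxU, hx⟩ := hmeet p hp
    have h1 := hU x hxU y₀ hy₀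
    have h2 : |p.2 - x| ≤ h p.1 := abs_le.2 ⟨by linarith [hx.2], by linarith [hx.1]⟩
    have h3 := abs_sub_le p.2 x y₀
    rw [Real.dist_eq]
    linarith [hh p hp, hθd p hp]
  have hvol := measure_mono (μ := volume) hsub
  rw [measure_biUnion_finset hdisj fun p _ => measurableSet_ball] at hvol
  simp only [Real.volume_ball] at hvol
  rw [← ENNReal.ofReal_sum_of_nonneg fun p hp => by have := hθ p hp; positivity,
    ENNReal.ofReal_le_ofReal_iff (by positivity), ← Finset.mul_sum] at hvol
  linarith

/-! ### Nested intervals avoiding a cover -/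

namespace UbiquitousLevels

variable {a b κ s : ℝ} {S : ℕ → Finset ℝ} {ρ r : ℕ → ℝ}

open Classical in
/-- The step of the Cantor-type construction. Let sets `U i` of diameters at most `d i` be given
with `∑ (d i) ^ s` finite. If the sets meeting `[p, q]` have total diameter at most
`κ / 64 * (q - p)`, the same holds for some interval of at most half the length inside `[p, q]`,
lying within `r n` of a point of `S n` for a large `n`.

Fill `[p, q]` by disjoint balls of radii `c * r n ^ s` and shrink each to length `r n`. By
`sum_radius_le_of_meets`, a set `U i` which meets several shrunk intervals only affects balls of
total radius `O(d i)`, which leaves half of the balls. Each remaining interval is met by sets that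
meet no other one, so if all of them violated the bound, then `∑ (d i) ^ s` would be at least of
order `∑ (r n) ^ s`, which is of order `(q - p) / c`. This is impossible when `c` is small. -/
theorem exists_child (H : UbiquitousLevels a b κ s S ρ r) {U : ℕ → Set ℝ} {d : ℕ → ℝ}
    (hd : ∀ i, 0 < d i) (hU : ∀ i, ∀ x ∈ U i, ∀ y ∈ U i, |x - y| ≤ d i)
    (hfin : ∑' i, ENNReal.ofReal (d i ^ s) ≠ ∞) {p q : ℝ} (hp : a ≤ p) (hpq : p < q) (hq : q ≤ b)
    (hQ : ∑' i, (if (U i ∩ Set.Icc p q).Nonempty then ENNReal.ofReal (d i) else 0) ≤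
      ENNReal.ofReal (κ / 64 * (q - p))) (N : ℕ) :
    ∃ n, N ≤ n ∧ ∃ y ∈ S n, ∃ p' q', p ≤ p' ∧ p' < q' ∧ q' ≤ q ∧ q' - p' ≤ (q - p) / 2 ∧
      Set.Icc p' q' ⊆ Metric.ball y (r n) ∧
      ∑' i, (if (U i ∩ Set.Icc p' q').Nonempty then ENNReal.ofReal (d i) else 0) ≤
        ENNReal.ofReal (κ / 64 * (q' - p')) := by
  have hκ := H.κ_pos
  have hs := H.s_pos
  have hr := H.r_pos
  have hrs : ∀ n, 0 < r n ^ s := fun n => Real.rpow_pos_of_pos (hr n) s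
  have hds : ∀ i, 0 < d i ^ s := fun i => Real.rpow_pos_of_pos (hd i) s
  have hlen : 0 < q - p := sub_pos.2 hpq
  set M := (∑' i, ENNReal.ofReal (d i ^ s)).toReal + 1 with hM
  have hM0 : 0 < M := by positivity
  have hMlt : ∑' i, ENNReal.ofReal (d i ^ s) < ENNReal.ofReal M := by
    rw [ENNReal.lt_ofReal_iff_toReal_lt hfin]
    linarith
  set η := κ / 64 with hη
  have hη0 : 0 < η := by positivity
  have hη1 : η ≤ 1 := by linarith [H.κ_le_one]
  -- With this `c`, the intervals left after discarding have `η * ∑ (r n) ^ s ≥ M`.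
  set c := η * κ * (q - p) / (16 * M) with hc
  have hc0 : 0 < c := by positivity
  obtain ⟨F, hF, hsep, hsum⟩ := H.exists_filling hp hpq hq hc0 N
  set θ : ℕ → ℝ := fun n => c * r n ^ s with hθ
  have hθ0 : ∀ n, 0 < θ n := fun n => mul_pos hc0 (hrs n)
  let J : ℕ × ℝ → Set ℝ := fun x => Set.Icc (x.2 - r x.1 / 2) (x.2 + r x.1 / 2)
  have hJ : ∀ x ∈ F, J x ⊆ Set.Icc p q := fun x hx =>
    Set.Icc_subset_Icc (hF x hx).2.2.2.2.1 (hF x hx).2.2.2.2.2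
  let K : ℕ → Finset (ℕ × ℝ) := fun i => F.filter fun x => (U i ∩ J x).Nonempty
  let Bad : Finset (ℕ × ℝ) := F.filter fun x => ∃ i, x ∈ K i ∧ (K i).Nontrivial
  have hbad : ∑ x ∈ Bad, θ x.1 ≤ κ * (q - p) / 16 := by
    have h1 : ∀ x ∈ Bad, ENNReal.ofReal (θ x.1) ≤
        ∑' i, if x ∈ K i ∧ (K i).Nontrivial then ENNReal.ofReal (θ x.1) else 0 := by
      intro x hx
      obtain ⟨i, hi⟩ := (Finset.mem_filter.1 hx).2
      refine le_trans (le_of_eq ?_) (ENNReal.le_tsum i)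
      rw [if_pos hi]
    have h2 : ∀ i, ∑ x ∈ F, (if x ∈ K i ∧ (K i).Nontrivial then ENNReal.ofReal (θ x.1) else 0) ≤
        4 * (if (U i ∩ Set.Icc p q).Nonempty then ENNReal.ofReal (d i) else 0) := by
      intro i
      by_cases hnt : (K i).Nontrivial
      · obtain ⟨x₀, hx₀⟩ := hnt.nonempty
        obtain ⟨hx₀F, hx₀U⟩ := Finset.mem_filter.1 hx₀
        have hne : (U i ∩ Set.Icc p q).Nonempty :=
          hx₀U.mono (Set.inter_subset_inter_right _ (hJ x₀ hx₀F))
        have h3 : ∑ x ∈ K i, θ x.1 ≤ 4 * d i := by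
          refine sum_radius_le_of_meets (h := fun n => r n / 2) (U := U i) (θ := θ)
            (fun x hx y hy => hsep x (Finset.filter_subset _ _ hx) y (Finset.filter_subset _ _ hy))
            hnt (fun x _ => hθ0 x.1) (fun x hx => ?_) (hU i) fun x hx => (Finset.mem_filter.1 hx).2
          have := (hF x (Finset.filter_subset _ _ hx)).2.2.1
          simp only [hθ]
          linarith
        simp only [hnt, and_true, if_pos hne]
        rw [← Finset.sum_filter, Finset.filter_mem_eq_inter,
          Finset.inter_eq_right.2 (Finset.filter_subset _ _),
          ← ENNReal.ofReal_sum_of_nonneg fun x _ => (hθ0 x.1).le]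
        refine (ENNReal.ofReal_le_ofReal h3).trans (le_of_eq ?_)
        rw [ENNReal.ofReal_mul (by norm_num)]
        simp
      · simp [hnt]
    have h4 : ENNReal.ofReal (∑ x ∈ Bad, θ x.1) ≤ ENNReal.ofReal (κ * (q - p) / 16) :=
      calc ENNReal.ofReal (∑ x ∈ Bad, θ x.1) = ∑ x ∈ Bad, ENNReal.ofReal (θ x.1) :=
            ENNReal.ofReal_sum_of_nonneg fun x _ => (hθ0 x.1).le
        _ ≤ ∑ x ∈ Bad, ∑' i, if x ∈ K i ∧ (K i).Nontrivial then ENNReal.ofReal (θ x.1) else 0 :=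
            Finset.sum_le_sum h1
        _ ≤ ∑ x ∈ F, ∑' i, if x ∈ K i ∧ (K i).Nontrivial then ENNReal.ofReal (θ x.1) else 0 :=
            Finset.sum_le_sum_of_subset (Finset.filter_subset _ _)
        _ = ∑' i, ∑ x ∈ F, if x ∈ K i ∧ (K i).Nontrivial then ENNReal.ofReal (θ x.1) else 0 :=
            (Summable.tsum_finsetSum fun _ _ => ENNReal.summable).symm
        _ ≤ ∑' i, 4 * (if (U i ∩ Set.Icc p q).Nonempty then ENNReal.ofReal (d i) else 0) :=
            ENNReal.tsum_le_tsum h2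
        _ ≤ 4 * ENNReal.ofReal (η * (q - p)) := by
            rw [ENNReal.tsum_mul_left]
            gcongr
        _ = ENNReal.ofReal (κ * (q - p) / 16) := by
            rw [show (4 : ℝ≥0∞) = ENNReal.ofReal 4 by simp, ← ENNReal.ofReal_mul (by norm_num), hη]
            ring_nf
    exact (ENNReal.ofReal_le_ofReal_iff (by positivity)).1 h4
  have hgood : ∃ x ∈ F, ∑' i, (if (U i ∩ J x).Nonempty then ENNReal.ofReal (d i ^ s) else 0) <
      ENNReal.ofReal (η * r x.1 ^ s) := by
    by_contra hcon
    push Not at hcon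
    have h1 : κ * (q - p) / 16 ≤ ∑ x ∈ F \ Bad, θ x.1 := by
      have := Finset.sum_sdiff (f := fun x : ℕ × ℝ => θ x.1) (Finset.filter_subset
        (fun x => ∃ i, x ∈ K i ∧ (K i).Nontrivial) F)
      change ∑ x ∈ F \ Bad, θ x.1 + ∑ x ∈ Bad, θ x.1 = ∑ x ∈ F, θ x.1 at this
      linarith
    have h2 : M ≤ ∑ x ∈ F \ Bad, η * r x.1 ^ s := by
      have e : ∑ x ∈ F \ Bad, η * r x.1 ^ s = η / c * ∑ x ∈ F \ Bad, θ x.1 := by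
        rw [Finset.mul_sum]
        refine Finset.sum_congr rfl fun x _ => ?_
        simp only [hθ]
        field_simp
      rw [e]
      calc M = η / c * (κ * (q - p) / 16) := by
            rw [hc]; field_simp
        _ ≤ _ := by gcongr
    have h3 : ∀ i, ∑ x ∈ F \ Bad, (if (U i ∩ J x).Nonempty then ENNReal.ofReal (d i ^ s) else 0) ≤
        ENNReal.ofReal (d i ^ s) := by
      intro i
      rw [← Finset.sum_filter, Finset.sum_const, nsmul_eq_mul]
      have hcard : ((F \ Bad).filter fun x => (U i ∩ J x).Nonempty).card ≤ 1 := by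
        rw [Finset.card_le_one]
        intro x hx y hy
        by_contra hxy
        obtain ⟨hx1, hx2⟩ := Finset.mem_filter.1 hx
        obtain ⟨hy1, hy2⟩ := Finset.mem_filter.1 hy
        obtain ⟨hxF, hxB⟩ := Finset.mem_sdiff.1 hx1
        have hxK : x ∈ K i := Finset.mem_filter.2 ⟨hxF, hx2⟩
        have hyK : y ∈ K i := Finset.mem_filter.2 ⟨(Finset.mem_sdiff.1 hy1).1, hy2⟩
        exact hxB (Finset.mem_filter.2 ⟨hxF, i, hxK, x, hxK, y, hyK, hxy⟩)
      calc _ ≤ (1 : ℝ≥0∞) * ENNReal.ofReal (d i ^ s) := by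
            gcongr
            exact_mod_cast hcard
        _ = _ := one_mul _
    have h4 : ENNReal.ofReal M ≤ ∑' i, ENNReal.ofReal (d i ^ s) :=
      calc ENNReal.ofReal M ≤ ENNReal.ofReal (∑ x ∈ F \ Bad, η * r x.1 ^ s) :=
            ENNReal.ofReal_le_ofReal h2
        _ = ∑ x ∈ F \ Bad, ENNReal.ofReal (η * r x.1 ^ s) :=
            ENNReal.ofReal_sum_of_nonneg fun x _ => (mul_pos hη0 (hrs x.1)).le
        _ ≤ ∑ x ∈ F \ Bad,
              ∑' i, (if (U i ∩ J x).Nonempty then ENNReal.ofReal (d i ^ s) else 0) :=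
            Finset.sum_le_sum fun x hx => hcon x (Finset.mem_sdiff.1 hx).1
        _ = ∑' i, ∑ x ∈ F \ Bad,
              (if (U i ∩ J x).Nonempty then ENNReal.ofReal (d i ^ s) else 0) :=
            (Summable.tsum_finsetSum fun _ _ => ENNReal.summable).symm
        _ ≤ _ := ENNReal.tsum_le_tsum h3
    exact absurd hMlt (not_lt.2 h4)
  obtain ⟨x, hxF, hx⟩ := hgood
  obtain ⟨hN, hxS, -, hrlen, hp', hq'⟩ := hF x hxF
  have hrx := hr x.1
  refine ⟨x.1, hN, x.2, hxS, x.2 - r x.1 / 2, x.2 + r x.1 / 2, hp', by linarith, hq', by linarith,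
    fun y hy => ?_, ?_⟩
  · rw [Metric.mem_ball, Real.dist_eq, abs_lt]
    exact ⟨by linarith [hy.1], by linarith [hy.2]⟩
  have hs1 : 0 ≤ 1 - s := by linarith [H.s_lt_one]
  -- A set meeting the new interval is shorter than it, so `d i ≤ (d i) ^ s * (r n) ^ (1 - s)`.
  have hterm : ∀ i, (if (U i ∩ J x).Nonempty then ENNReal.ofReal (d i) else 0) ≤
      (if (U i ∩ J x).Nonempty then ENNReal.ofReal (d i ^ s) else 0) *
        ENNReal.ofReal (r x.1 ^ (1 - s)) := by
    intro i
    by_cases hi : (U i ∩ J x).Nonempty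
    · have h1 : ENNReal.ofReal (d i ^ s) < ENNReal.ofReal (η * r x.1 ^ s) := by
        refine lt_of_le_of_lt (le_trans (le_of_eq ?_) (ENNReal.le_tsum i)) hx
        rw [if_pos hi]
      have h2 := (ENNReal.ofReal_lt_ofReal_iff (mul_pos hη0 (hrs _))).1 h1
      have h3 : d i ^ s ≤ r x.1 ^ s := by nlinarith [hrs x.1]
      have h4 : d i ≤ r x.1 := (Real.rpow_le_rpow_iff (hd i).le hrx.le hs).1 h3
      rw [if_pos hi, if_pos hi, ← ENNReal.ofReal_mul (hds i).le]
      refine ENNReal.ofReal_le_ofReal ?_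
      calc d i = d i ^ s * d i ^ (1 - s) := by rw [← Real.rpow_add (hd i)]; simp
        _ ≤ d i ^ s * r x.1 ^ (1 - s) :=
          mul_le_mul_of_nonneg_left (Real.rpow_le_rpow (hd i).le h4 hs1) (hds i).le
    · simp [hi]
  calc _ ≤ ∑' i, (if (U i ∩ J x).Nonempty then ENNReal.ofReal (d i ^ s) else 0) *
        ENNReal.ofReal (r x.1 ^ (1 - s)) := ENNReal.tsum_le_tsum hterm
    _ ≤ ENNReal.ofReal (η * r x.1 ^ s) * ENNReal.ofReal (r x.1 ^ (1 - s)) := by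
      rw [ENNReal.tsum_mul_right]
      gcongr
    _ = ENNReal.ofReal (η * (x.2 + r x.1 / 2 - (x.2 - r x.1 / 2))) := by
      rw [← ENNReal.ofReal_mul (mul_pos hη0 (hrs _)).le, mul_assoc, ← Real.rpow_add hrx]
      congr 1
      simp

open Classical in
/-- Iterating `exists_child` gives nested intervals whose common point lies in none of the sets
`U i`: a set meeting all of these intervals would have diameter bound `d i = 0`. -/
theorem exists_notMem_iUnion (H : UbiquitousLevels a b κ s S ρ r) (hab : a < b) {U : ℕ → Set ℝ}
    {d : ℕ → ℝ} (hd : ∀ i, 0 < d i) (hU : ∀ i, ∀ x ∈ U i, ∀ y ∈ U i, |x - y| ≤ d i)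
    (hfin : ∑' i, ENNReal.ofReal (d i ^ s) ≠ ∞)
    (hQ : ∑' i, ENNReal.ofReal (d i) ≤ ENNReal.ofReal (κ / 64 * (b - a))) :
    ∃ x ∈ Set.Icc a b, (∃ᶠ n in atTop, ∃ y ∈ S n, |x - y| < r n) ∧ ∀ i, x ∉ U i := by
  have hκ := H.κ_pos
  let P : ℝ × ℝ → Prop := fun I => a ≤ I.1 ∧ I.1 < I.2 ∧ I.2 ≤ b ∧
    ∑' i, (if (U i ∩ Set.Icc I.1 I.2).Nonempty then ENNReal.ofReal (d i) else 0) ≤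
      ENNReal.ofReal (κ / 64 * (I.2 - I.1))
  have hstep : ∀ (N : ℕ) (I : {I // P I}), ∃ I' : {I // P I},
      Set.Icc I'.1.1 I'.1.2 ⊆ Set.Icc I.1.1 I.1.2 ∧ I'.1.2 - I'.1.1 ≤ (I.1.2 - I.1.1) / 2 ∧
      ∃ n, N ≤ n ∧ ∃ y ∈ S n, Set.Icc I'.1.1 I'.1.2 ⊆ Metric.ball y (r n) := by
    rintro N ⟨⟨p, q⟩, hp, hpq, hq, hI⟩
    obtain ⟨n, hn, y, hy, p', q', h1, h2, h3, h4, h5, h6⟩ :=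
      H.exists_child hd hU hfin hp hpq hq hI N
    exact ⟨⟨(p', q'), le_trans hp h1, h2, le_trans h3 hq, h6⟩, Set.Icc_subset_Icc h1 h3, h4,
      n, hn, y, hy, h5⟩
  choose next hsub hhalf hball using hstep
  have hroot : P (a, b) := by
    refine ⟨le_rfl, hab, le_rfl, le_trans (ENNReal.tsum_le_tsum fun i => ?_) hQ⟩
    split_ifs
    exacts [le_rfl, zero_le]
  let I : ℕ → {I // P I} := fun k => Nat.rec ⟨(a, b), hroot⟩ next k
  have hlen : ∀ k, (I k).1.2 - (I k).1.1 ≤ (b - a) * (1 / 2) ^ k := by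
    intro k
    induction k with
    | zero => simp [I]
    | succ k ih =>
      have : (I (k + 1)).1.2 - (I (k + 1)).1.1 ≤ ((I k).1.2 - (I k).1.1) / 2 := hhalf k (I k)
      rw [pow_succ]
      linarith
  obtain ⟨x, hx⟩ := IsCompact.nonempty_iInter_of_sequence_nonempty_isCompact_isClosed
    (fun k => Set.Icc (I k).1.1 (I k).1.2) (fun k => hsub k (I k))
    (fun k => Set.nonempty_Icc.2 (I k).2.2.1.le) isCompact_Icc fun _ => isClosed_Icc
  rw [Set.mem_iInter] at hx
  refine ⟨x, hx 0, frequently_atTop.2 fun N => ?_, fun i hi => ?_⟩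
  · obtain ⟨n, hn, y, hy, hxy⟩ := hball N (I N)
    refine ⟨n, hn, y, hy, ?_⟩
    have := hxy (hx (N + 1))
    rwa [Metric.mem_ball, Real.dist_eq] at this
  · have h1 : ∀ k, d i ≤ κ / 64 * ((b - a) * (1 / 2) ^ k) := by
      intro k
      have h2 : ENNReal.ofReal (d i) ≤ ENNReal.ofReal (κ / 64 * ((I k).1.2 - (I k).1.1)) := by
        refine le_trans (le_trans (le_of_eq ?_) (ENNReal.le_tsum i)) (I k).2.2.2.2
        rw [if_pos ⟨x, hi, hx k⟩]
      have h3 := (ENNReal.ofReal_le_ofReal_iff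
        (mul_nonneg (by positivity) (sub_nonneg.2 (I k).2.2.1.le))).1 h2
      exact h3.trans (mul_le_mul_of_nonneg_left (hlen k) (by positivity))
    have h4 : Tendsto (fun k : ℕ => κ / 64 * ((b - a) * (1 / 2 : ℝ) ^ k)) atTop (𝓝 0) := by
      simpa using ((tendsto_pow_atTop_nhds_zero_of_lt_one (r := (1 / 2 : ℝ)) (by norm_num)
        (by norm_num)).const_mul (b - a)).const_mul (κ / 64)
    exact absurd (ge_of_tendsto' h4 h1) (not_le.2 (hd i))

end UbiquitousLevels

/-! ### Hausdorff measure -/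

/-- If the Hausdorff measure were finite, the set would have covers of bounded `s`-dimensional sum
by sets so short that their total diameter is as small as desired. After a slight enlargement,
which makes all the diameter bounds positive, `exists_notMem_iUnion` produces a point outside the
cover. -/
theorem UbiquitousLevels.hausdorffMeasure_eq_top {a b κ s : ℝ} {S : ℕ → Finset ℝ} {ρ r : ℕ → ℝ}
    (H : UbiquitousLevels a b κ s S ρ r) (hab : a < b) :
    Measure.hausdorffMeasure s
      {x | x ∈ Set.Icc a b ∧ ∃ᶠ n in atTop, ∃ y ∈ S n, |x - y| < r n} = ∞ := by
  set Λ : Set ℝ := {x | x ∈ Set.Icc a b ∧ ∃ᶠ n in atTop, ∃ y ∈ S n, |x - y| < r n} with hΛ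
  by_contra hne
  have hκ := H.κ_pos
  have hs := H.s_pos
  have hs1 : 0 < 1 - s := by linarith [H.s_lt_one]
  have hba : 0 < b - a := sub_pos.2 hab
  set τ := κ / 64 * (b - a) with hτ
  have hτ0 : 0 < τ := by positivity
  set M := (Measure.hausdorffMeasure s Λ).toReal + 1 with hM
  have hM0 : 0 < M := by positivity
  have hlt : Measure.hausdorffMeasure s Λ < ENNReal.ofReal M := by
    rw [ENNReal.lt_ofReal_iff_toReal_lt hne]
    linarith
  -- The bound `δ` on the diameters satisfies `δ ^ (1 - s) * M = τ / 2`.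
  set δ := (τ / (2 * M)) ^ (1 / (1 - s)) with hδ
  have hδ0 : 0 < δ := by positivity
  have hδs : δ ^ (1 - s) = τ / (2 * M) := by
    rw [hδ, ← Real.rpow_mul (by positivity), one_div_mul_cancel hs1.ne', Real.rpow_one]
  rw [Measure.hausdorffMeasure_apply] at hlt
  have hlt' := lt_of_le_of_lt (le_iSup₂ (f := fun (r : ℝ≥0∞) (_ : 0 < r) =>
    ⨅ (t : ℕ → Set ℝ) (_ : Λ ⊆ ⋃ n, t n) (_ : ∀ n, Metric.ediam (t n) ≤ r),
      ∑' n, ⨆ _ : (t n).Nonempty, Metric.ediam (t n) ^ s)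
    (ENNReal.ofReal δ) (ENNReal.ofReal_pos.2 hδ0)) hlt
  simp only [iInf_lt_iff] at hlt'
  obtain ⟨t, hcov, hdiam, hsum⟩ := hlt'
  have hterm : ∀ n, ⨆ _ : (t n).Nonempty, Metric.ediam (t n) ^ s = Metric.ediam (t n) ^ s := by
    intro n
    rcases (t n).eq_empty_or_nonempty with h | h
    · simp [h, hs]
    · simp [h]
  simp only [hterm] at hsum
  have hfin : ∀ n, Metric.ediam (t n) ≠ ∞ := fun n =>
    ((hdiam n).trans_lt ENNReal.ofReal_lt_top).ne
  let e : ℕ → ℝ := fun n => τ / 4 * (1 / 2) ^ n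
  have he : ∀ n, 0 < e n := fun n => by positivity
  let d : ℕ → ℝ := fun n => (Metric.ediam (t n)).toReal + e n
  have hd : ∀ n, 0 < d n := fun n => add_pos_of_nonneg_of_pos ENNReal.toReal_nonneg (he n)
  have hdof : ∀ n, ENNReal.ofReal (d n) = Metric.ediam (t n) + ENNReal.ofReal (e n) := fun n => by
    rw [ENNReal.ofReal_add ENNReal.toReal_nonneg (he n).le, ENNReal.ofReal_toReal (hfin n)]
  have hdU : ∀ n, ∀ x ∈ t n, ∀ y ∈ t n, |x - y| ≤ d n := by
    intro n x hx y hy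
    have h1 : edist x y ≤ Metric.ediam (t n) := Metric.edist_le_ediam_of_mem hx hy
    rw [edist_dist, ENNReal.ofReal_le_iff_le_toReal (hfin n), Real.dist_eq] at h1
    exact h1.trans (le_add_of_nonneg_right (he n).le)
  have hes : Summable fun n => e n ^ s := by
    have h1 : ∀ n, e n ^ s = (τ / 4) ^ s * ((1 / 2 : ℝ) ^ s) ^ n := fun n => by
      rw [Real.mul_rpow (by positivity) (by positivity), ← Real.rpow_natCast, ← Real.rpow_natCast,
        ← Real.rpow_mul (by positivity), ← Real.rpow_mul (by positivity), mul_comm s]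
    simp_rw [h1]
    exact (summable_geometric_of_lt_one (by positivity)
      (Real.rpow_lt_one (by norm_num) (by norm_num) hs)).mul_left _
  have hesum : ∑' n, ENNReal.ofReal (e n) = ENNReal.ofReal (τ / 2) := by
    rw [← ENNReal.ofReal_tsum_of_nonneg (fun n => (he n).le)
      (summable_geometric_two.mul_left _), tsum_mul_left, tsum_geometric_two]
    ring_nf
  have hds : ∑' n, ENNReal.ofReal (d n ^ s) ≠ ∞ := by
    have h1 : ∀ n, ENNReal.ofReal (d n ^ s) ≤
        Metric.ediam (t n) ^ s + ENNReal.ofReal (e n ^ s) := fun n => by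
      rw [← ENNReal.ofReal_rpow_of_pos (hd n), ← ENNReal.ofReal_rpow_of_pos (he n), hdof]
      exact ENNReal.rpow_add_le_add_rpow _ _ hs.le H.s_lt_one.le
    refine ((ENNReal.tsum_le_tsum h1).trans_lt ?_).ne
    rw [ENNReal.tsum_add]
    exact ENNReal.add_lt_top.2 ⟨hsum.trans ENNReal.ofReal_lt_top,
      hes.tsum_ofReal_ne_top.lt_top⟩
  have hdQ : ∑' n, ENNReal.ofReal (d n) ≤ ENNReal.ofReal (κ / 64 * (b - a)) := by
    have h1 : ∀ n, Metric.ediam (t n) ≤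
        Metric.ediam (t n) ^ s * ENNReal.ofReal (τ / (2 * M)) := fun n =>
      calc Metric.ediam (t n) = Metric.ediam (t n) ^ s * Metric.ediam (t n) ^ (1 - s) := by
            rw [← ENNReal.rpow_add_of_nonneg _ _ hs.le hs1.le]; simp
        _ ≤ _ := by
            rw [← hδs, ← ENNReal.ofReal_rpow_of_pos hδ0]
            gcongr
            exact hdiam n
    simp only [hdof]
    rw [ENNReal.tsum_add, hesum]
    calc _ ≤ ENNReal.ofReal M * ENNReal.ofReal (τ / (2 * M)) + ENNReal.ofReal (τ / 2) := by
          gcongr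
          refine (ENNReal.tsum_le_tsum h1).trans ?_
          rw [ENNReal.tsum_mul_right]
          gcongr
      _ = ENNReal.ofReal τ := by
          have h2 : M * (τ / (2 * M)) = τ / 2 := by field_simp
          rw [← ENNReal.ofReal_mul hM0.le, h2, ← ENNReal.ofReal_add (by positivity) (by positivity),
            add_halves]
  obtain ⟨x, hx, hfreq, hxt⟩ := H.exists_notMem_iUnion hab hd hdU hds hdQ
  obtain ⟨n, hn⟩ := Set.mem_iUnion.1 (hcov ⟨hx, hfreq⟩)
  exact hxt n hn

theorem finite_indexSet {J : Type*} {β : J → ℝ} (hfin : ∀ t : ℕ, (indexSet β (2 ^ t)).Finite)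
    (T : ℝ) : (indexSet β T).Finite := by
  obtain ⟨t, ht⟩ := pow_unbounded_of_one_lt T (one_lt_two : (1 : ℝ) < 2)
  exact (hfin t).subset fun α hα => le_trans hα ht.le

/-- The two parts of the theorem reduce to this: it is enough to know the ubiquity along a sequence
of levels `φ n`, and to have radii `r n ≤ Ψ (u (φ n))` that decay geometrically with divergent
sum of `r n ^ s / ρ (u (φ n))`. A point `R α` may lie in the balls of infinitely many levels
merely because of the single index `α`, but these points form a countable set, of measure zero. -/
theorem hausdorffMeasure_limsupSet_eq_top {J : Type*} [Countable J] {I₀ : Set ℝ}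
    (hI₀ : I₀.OrdConnected) (hI₀' : I₀.Nontrivial) {R β : J → ℝ} (hβ : ∀ α, 0 < β α)
    (hfin : ∀ t : ℕ, (indexSet β (2 ^ t)).Finite) {ρ : ℝ → ℝ} (hρ : ∀ t, 0 < t → 0 < ρ t)
    (hρ' : Tendsto ρ atTop (𝓝 0)) {u : ℕ → ℝ} (hu : ∀ n, 0 < u n) (hu_lim : Tendsto u atTop atTop)
    (hub : LocallyUbiquitous I₀ R β ρ u) {Ψ : ℝ → ℝ} (hΨ : AntitoneOn Ψ (Set.Ioi 0))
    {s : ℝ} (hs0 : 0 < s) (hs1 : s < 1) {φ : ℕ → ℕ} (hφ : Tendsto φ atTop atTop) {r : ℕ → ℝ}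
    (hr : ∀ n, 0 < r n) (hrΨ : ∀ n, r n ≤ Ψ (u (φ n)))
    (hdecay : ∃ l : ℝ, 0 < l ∧ l < 1 ∧ ∀ n, r (n + 1) ≤ l * r n)
    (hdiv : ¬ Summable fun n => r n ^ s / ρ (u (φ n))) :
    Measure.hausdorffMeasure s (limsupSet I₀ R β Ψ) = ∞ := by
  classical
  obtain ⟨a, ha, b, hb, hab⟩ := hI₀'.exists_lt
  have hsub : Set.Icc a b ⊆ I₀ := hI₀.out ha hb
  obtain ⟨κ, hκ, hκub⟩ := hub
  let S : ℕ → Finset ℝ := fun n => (finite_indexSet hfin (u (φ n))).toFinset.image R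
  have hS : ∀ n y, y ∈ S n ↔ ∃ α, β α ≤ u (φ n) ∧ R α = y := fun n y => by
    simp [S, indexSet]
  have H : UbiquitousLevels a b (min κ 1) s S (fun n => ρ (u (φ n))) r :=
    { s_pos := hs0
      s_lt_one := hs1
      κ_pos := lt_min hκ one_pos
      κ_le_one := min_le_right _ _
      ρ_pos := fun n => hρ _ (hu _)
      tendsto_ρ := hρ'.comp (hu_lim.comp hφ)
      r_pos := hr
      decay := hdecay
      not_summable := hdiv
      ubiquitous := by
        intro p q hp hpq hq
        have h1 := hφ.eventually (hκub (Set.Icc p q) Set.ordConnected_Icc (Metric.isBounded_Icc p q)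
          ((Set.Icc_subset_Icc hp hq).trans hsub))
        filter_upwards [h1] with n hn
        have h2 : (⋃ x ∈ S n, Metric.ball x (ρ (u (φ n)))) = delta R β ρ u (φ n) := by
          ext y
          simp only [delta, indexSet, Set.mem_iUnion, hS, Set.mem_ofPred_eq, exists_prop]
          constructor
          · rintro ⟨_, ⟨α, hα, rfl⟩, hy⟩
            exact ⟨α, hα, hy⟩
          · rintro ⟨α, hα, hy⟩
            exact ⟨_, ⟨α, hα, rfl⟩, hy⟩
        rw [h2]
        refine le_trans ?_ hn
        rw [Real.volume_Icc, ← ENNReal.ofReal_mul hκ.le]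
        exact ENNReal.ofReal_le_ofReal
          (mul_le_mul_of_nonneg_right (min_le_left _ _) (sub_pos.2 hpq).le) }
  have hincl : {x | x ∈ Set.Icc a b ∧ ∃ᶠ n in atTop, ∃ y ∈ S n, |x - y| < r n} ⊆
      limsupSet I₀ R β Ψ ∪ Set.range R := by
    rintro x ⟨hxab, hx⟩
    by_cases hxR : x ∈ Set.range R
    · exact Or.inr hxR
    refine Or.inl ⟨hsub hxab, fun hF => ?_⟩
    -- If the set of indices were finite, `r n` would drop below all the distances `|x - R α|`.
    have h1 : ∀ᶠ n in atTop, ∀ α ∈ {α : J | |x - R α| < Ψ (β α)}, r n < |x - R α| := by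
      refine (eventually_all_finite hF).2 fun α _ => H.tendsto_r.eventually (gt_mem_nhds ?_)
      exact abs_pos.2 (sub_ne_zero.2 fun h => hxR ⟨α, h.symm⟩)
    obtain ⟨n, ⟨y, hy, hlt⟩, hn⟩ := (hx.and_eventually h1).exists
    obtain ⟨α, hα, rfl⟩ := (hS n y).1 hy
    have h2 : Ψ (u (φ n)) ≤ Ψ (β α) := hΨ (hβ α) (hu _) hα
    exact absurd (hn α (hlt.trans_le ((hrΨ n).trans h2))) (not_lt.2 hlt.le)
  have hzero : Measure.hausdorffMeasure s (Set.range R) = 0 := by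
    have := Measure.nullSingletonClass_hausdorff ℝ hs0
    exact (Set.countable_range R).measure_zero _
  have htop := H.hausdorffMeasure_eq_top hab
  have h3 := (measure_mono (μ := Measure.hausdorffMeasure s) hincl).trans (measure_union_le _ _)
  rw [htop, hzero, add_zero] at h3
  exact top_le_iff.1 h3

end Ubiquity

theorem mainTheorem11 {J : Type*} [Countable J] [Infinite J]
    (I₀ : Set ℝ) (hI₀ : I₀.OrdConnected) (hI₀' : I₀.Nontrivial)
    (R : J → ℝ) (hR : ∀ α, R α ∈ I₀)
    (β : J → ℝ) (hβ : ∀ α, 0 < β α)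
    (hfin : ∀ t : ℕ, (Ubiquity.indexSet β (2 ^ t)).Finite)
    (ρ : ℝ → ℝ) (hρ : ∀ t, 0 < t → 0 < ρ t) (hρ' : Tendsto ρ atTop (𝓝 0))
    (u : ℕ → ℝ) (hu : ∀ n, 0 < u n) (hu_mono : Monotone u) (hu_lim : Tendsto u atTop atTop)
    (hub : Ubiquity.LocallyUbiquitous I₀ R β ρ u)
    (Ψ : ℝ → ℝ) (hΨ : ∀ t, 0 < t → 0 < Ψ t) (hΨ_anti : AntitoneOn Ψ (Set.Ioi 0))
    (s : ℝ) (hs0 : 0 < s) (hs1 : s < 1) :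
    (Ubiquity.G Ψ ρ u s = 0 → Ubiquity.IsRegularAlong u Ψ →
        ∑' n, Ubiquity.ratio Ψ ρ u s n = ∞ →
        Measure.hausdorffMeasure s (Ubiquity.limsupSet I₀ R β Ψ) = ∞) ∧
      (0 < Ubiquity.G Ψ ρ u s →
        Measure.hausdorffMeasure s (Ubiquity.limsupSet I₀ R β Ψ) = ∞) := by
  constructor
  · rintro - ⟨c, hc0, hc1, hreg⟩ hsum
    obtain ⟨N, hN⟩ := eventually_atTop.1 hreg
    refine Ubiquity.hausdorffMeasure_limsupSet_eq_top hI₀ hI₀' hβ hfin hρ hρ' hu hu_lim hub hΨ_anti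
      hs0 hs1 (tendsto_add_atTop_nat N) (r := fun n => Ψ (u (n + N))) (fun n => hΨ _ (hu _))
      (fun n => le_rfl) ⟨c, hc0, hc1, fun n => ?_⟩ fun h => ?_
    · have := hN (n + N) (Nat.le_add_left _ _)
      rwa [show n + N + 1 = n + 1 + N by omega] at this
    · exact ((summable_nat_add_iff (f := fun n => Ψ (u n) ^ s / ρ (u n)) N).1 h).tsum_ofReal_ne_top
        hsum
  · intro hG
    obtain ⟨c, hc0, hcG⟩ := exists_between hG
    have hfreq : ∃ᶠ n in atTop, c < Ubiquity.ratio Ψ ρ u s n := frequently_lt_of_lt_limsup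
      (by isBoundedDefault) hcG
    have hctop : c ≠ ∞ := (hcG.trans_le le_top).ne
    have hcR : 0 < c.toReal := ENNReal.toReal_pos hc0.ne' hctop
    -- Lowering the radii to `ρ ^ (1 / s)` makes them tend to zero, and keeps the ratio at `1`.
    let r : ℕ → ℝ := fun n => min (Ψ (u n)) (ρ (u n) ^ (1 / s))
    have hρu : ∀ n, 0 < ρ (u n) := fun n => hρ _ (hu n)
    have hr : ∀ n, 0 < r n := fun n => lt_min (hΨ _ (hu n)) (Real.rpow_pos_of_pos (hρu n) _)
    have hrlim : Tendsto r atTop (𝓝 0) := by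
      have h1 : Tendsto (fun n => ρ (u n) ^ (1 / s)) atTop (𝓝 0) := by
        have := (hρ'.comp hu_lim).rpow_const (p := 1 / s) (Or.inr (by positivity))
        rwa [Real.zero_rpow (by positivity)] at this
      exact squeeze_zero (fun n => (hr n).le) (fun n => min_le_right _ _) h1
    have hgood : ∃ᶠ n in atTop, min c.toReal 1 ≤ r n ^ s / ρ (u n) := by
      refine hfreq.mono fun n hn => ?_
      have h1 : c.toReal < Ψ (u n) ^ s / ρ (u n) :=
        (ENNReal.lt_ofReal_iff_toReal_lt hctop).1 hn
      rcases min_choice (Ψ (u n)) (ρ (u n) ^ (1 / s)) with h | h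
      · simp only [r, h]
        exact (min_le_left _ _).trans h1.le
      · simp only [r, h]
        rw [← Real.rpow_mul (hρu n).le, one_div_mul_cancel hs0.ne', Real.rpow_one,
          div_self (hρu n).ne']
        exact min_le_right _ _
    obtain ⟨φ, hφ, hφr⟩ := exists_seq_of_forall_finset_exists
      (fun n => min c.toReal 1 ≤ r n ^ s / ρ (u n)) (fun m n => m < n ∧ r n ≤ 1 / 2 * r m)
      (fun T _ => by
        have h1 : ∀ᶠ n in atTop, ∀ m ∈ T, m < n ∧ r n ≤ 1 / 2 * r m := by
          refine (Filter.eventually_all_finset T).2 fun m _ => ?_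
          filter_upwards [eventually_gt_atTop m,
            hrlim.eventually (gt_mem_nhds (show 0 < 1 / 2 * r m by linarith [hr m]))]
            with n hn hn'
          exact ⟨hn, hn'.le⟩
        exact (hgood.and_eventually h1).exists)
    have hφmono : StrictMono φ := fun m n h => (hφr m n h).1
    refine Ubiquity.hausdorffMeasure_limsupSet_eq_top hI₀ hI₀' hβ hfin hρ hρ' hu hu_lim hub hΨ_anti
      hs0 hs1 hφmono.tendsto_atTop (r := r ∘ φ) (fun n => hr _) (fun n => min_le_left _ _)
      ⟨1 / 2, by norm_num, by norm_num, fun n => (hφr n (n + 1) n.lt_succ_self).2⟩ fun h => ?_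
    have h1 := ge_of_tendsto' h.tendsto_atTop_zero hφ
    exact absurd h1 (not_le.2 (lt_min hcR one_pos))
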